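/- **Model.** The full data are $D=(X,U,Z,Y)$ with $X\in\mathbb R^p$ observed covariates, $U\in\mathbb R$ an unmeasured confounder, $Z\in\mathbb R$ the treatment and $Y\in\mathbb R$ the response; only $O=(X,Z,Y)$ is observed. Let $\theta=(\lambda,\beta,\kappa)\in\mathbb R^{q}$, $q=2p+1$, and let $\delta,\gamma$ be known. The model $\mathcal M_U$ consists of the laws $$f(Y\mid X,U,Z;\lambda,\beta,\delta)\,f(Z\mid X,U;\kappa,\gamma)\,F(dU\mid X)\,F(dX)$$ with $F(dX)$ and $F(dU\mid X)$ arbitrary, where $Y$ and $Z$ follow exponential families (given base measures and dispersions) with canonical links and linear predictors $\lambda^TX+\beta Z+\delta U$ and $\kappa^TX+\gamma U$, the natural parameters lying almost everywhere in the interior of the natural parameter spaces. Fix a law in $\mathcal M_U$ (the true law) and let $\mathbb E$ be expectation under it. Let $S_\theta(X,U,Z,Y)$ be the gradient in $\theta$ of $\log\{f(Y\mid X,U,Z)f(Z\mid X,U)\}$ at the true $\theta$, assume it is square integrable, and let $S_\theta(X,Z,Y)=\mathbb E[S_\theta(X,U,Z,Y)\mid X,Z,Y]$. All functions below take values in $\mathbb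 R^q$, $L^2$ has inner product $\mathbb E[h^Tg]$, and $L^2(X,Z,Y)$ denotes the square integrable functions of $(X,Z,Y)$. Let $\Lambda_1=\{a_1(X)\in L^2:\mathbb E[a_1]=0\}$ and $\Lambda_2=\{\mathbb E[a_2(U,X)\mid X,Z,Y]: a_2\in L^2,\ \mathbb E[a_2\mid X]=0\}$. The observed-data nuisance tangent space $\Lambda$ is the $L^2$-closure of $\Lambda_1\oplus\Lambda_2$, and $\Pi[\cdot\mid\Lambda]$ is the orthogonal projection onto it. The efficient score is $S_{\rm eff}=S_\theta(X,Z,Y)-\Pi[S_\theta(X,Z,Y)\mid\Lambda]$, and $V_{\rm eff}=\mathbb E[S_{\rm eff}S_{\rm eff}^T]$. An (observed-data) influence function is a mean-zero $\varphi(X,Z,Y)\in L^2$ orthogonal to $\Lambda$ with $\mathbb E[\varphi\,S_\theta(X,Z,Y)^T]=I$. **Theorem.** 1. The ortho-complement of $\Lambda$ in $L^2(X,Z,Y)$ is $\{h-\Pi[h\mid\Lambda]: h\in L^2(X,Z,Y)\}$; likewise, its ortho-complement in the mean-zero subspace of $L^2(X,Z,Y)$ is obtained by letting $h$ range over that subspace.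 2. Let $a(U,X)\in L^2$ with $\mathbb E[a\mid X]=0$. Then $$S_{\rm eff}=S_\theta(X,Z,Y)-\mathbb E[a(U,X)\mid X,Z,Y]$$ if and only if $a$ solves the integral equation $$\mathbb E[S_\theta(X,Z,Y)\mid X,U]=\mathbb E\{\mathbb E[a(U,X)\mid X,Z,Y]\mid X,U\}.$$ Such a solution $a$ exists if and only if $\Pi[S_\theta(X,Z,Y)\mid\Lambda]\in\Lambda_1\oplus\Lambda_2$ (in particular whenever $\Lambda_1\oplus\Lambda_2$ is closed). 3. $V_{\rm eff}$ is the semiparametric information bound for $\theta$ in $\mathcal M_U$: it is the least element, in the Loewner order, of $\{\mathbb E[(S_\theta(X,Z,Y)-g)(S_\theta(X,Z,Y)-g)^T]: g\in\Lambda\}$. It is nonsingular if and only if an influence function exists. In that case $V_{\rm eff}^{-1}S_{\rm eff}$ is the efficient influence function, that is, an influence function whose variance $\mathbb E[\varphi\varphi^T]$ is least in the Loewner order among all influence functions, and the semiparametric efficiency bound, its variance, is $V_{\rm eff}^{-1}$. -/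

import Mathlib

open MeasureTheory ProbabilityTheory
open scoped InnerProductSpace

noncomputable section

namespace Sensitivity

/-- The space of the observed covariate vector `X`. -/
abbrev Covariate (p : ℕ) : Type := EuclideanSpace ℝ (Fin p)

/-- Full data `D = ((X, U), (Z, Y))`: covariates, scalar unmeasured confounder, treatment,
response. -/
abbrev FullData (p : ℕ) : Type := (Covariate p × ℝ) × (ℝ × ℝ)

/-- Indices of `θ = (lam, β, κ)`; so `q = p + 1 + p`. -/
abbrev ParamIdx (p : ℕ) : Type := Fin p ⊕ Unit ⊕ Fin p

/-- The parameter space `ℝ^q`, also the value space of scores, with the Euclidean norm. -/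
abbrev Param (p : ℕ) : Type := EuclideanSpace ℝ (ParamIdx p)

/-! ### The semiparametric model -/

/-- Density at `y`, relative to `ν`, of the exponential family with base measure `ν`, known
dispersion `φ` and canonical link, at the value `η` of the linear predictor:
`exp (y η / φ - log ∫ exp (t η / φ) dν(t))`.  Its mean is `(cgf id ν)' (η / φ)`, the inverse
canonical link evaluated at `η`. -/
def expFamDensity (ν : Measure ℝ) (φ η y : ℝ) : ℝ :=
  Real.exp (y * (η / φ) - cgf id ν (η / φ))

/-- The known ingredients of the model: base measures and dispersions of the exponential
families of `Y` and of `Z`, and the sensitivity parameters `δ` (effect of `U` on `Y`) and `γ`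
(effect of `U` on `Z`). -/
structure Model where
  νY : Measure ℝ
  νZ : Measure ℝ
  sigmaFiniteY : SigmaFinite νY
  sigmaFiniteZ : SigmaFinite νZ
  νY_ne_zero : νY ≠ 0
  νZ_ne_zero : νZ ≠ 0
  φY : ℝ
  φZ : ℝ
  φY_pos : 0 < φY
  φZ_pos : 0 < φZ
  δ : ℝ
  γ : ℝ

attribute [instance] Model.sigmaFiniteY Model.sigmaFiniteZ

variable {p : ℕ}

/-- Linear predictor `lamᵀ x + β z + δ u` of the outcome model. -/
def Model.predY (M : Model) (θ : Param p) (xu : Covariate p × ℝ) (z : ℝ) : ℝ :=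
  ∑ j, θ (Sum.inl j) * xu.1 j + θ (Sum.inr (Sum.inl ())) * z + M.δ * xu.2

/-- Linear predictor `κᵀ x + γ u` of the propensity score model. -/
def Model.predZ (M : Model) (θ : Param p) (xu : Covariate p × ℝ) : ℝ :=
  ∑ j, θ (Sum.inr (Sum.inr j)) * xu.1 j + M.γ * xu.2

/-- `f(y ∣ x, u, z; lam, β, δ) * f(z ∣ x, u; κ, γ)`. -/
def Model.density (M : Model) (θ : Param p) (d : FullData p) : ℝ :=
  expFamDensity M.νY M.φY (M.predY θ d.1 d.2.1) d.2.2 *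
    expFamDensity M.νZ M.φZ (M.predZ θ d.1) d.2.1

/-- A law in the model: a value of `θ`, an arbitrary law `F(X)`, an arbitrary conditional law
`F(U ∣ X)`, such that almost every linear predictor corresponds to an interior point of the
natural parameter space of its exponential family. -/
structure Model.Point (M : Model) (p : ℕ) where
  θ : Param p
  lawX : Measure (Covariate p)
  probX : IsProbabilityMeasure lawX
  lawU : Kernel (Covariate p) ℝ
  markovU : IsMarkovKernel lawU
  naturalZ : ∀ᵐ xu ∂(lawX ⊗ₘ lawU),
    M.predZ θ xu / M.φZ ∈ interior (integrableExpSet id M.νZ)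
  naturalY : ∀ᵐ w ∂((lawX ⊗ₘ lawU).prod M.νZ),
    M.predY θ w.1 w.2 / M.φY ∈ interior (integrableExpSet id M.νY)

attribute [instance] Model.Point.probX Model.Point.markovU

variable {M : Model}

/-- The law of the full data:
`f(Y ∣ X, U, Z) * f(Z ∣ X, U) * F(dU ∣ X) * F(dX)`. -/
def Model.Point.law (P : M.Point p) : Measure (FullData p) :=
  ((P.lawX ⊗ₘ P.lawU).prod (M.νZ.prod M.νY)).withDensity
    fun d => ENNReal.ofReal (M.density P.θ d)

lemma measurable_cgf_id (ν : Measure ℝ) [SigmaFinite ν] : Measurable (cgf id ν) := by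
  unfold cgf mgf
  refine Real.measurable_log.comp ?_
  refine StronglyMeasurable.measurable ?_
  refine StronglyMeasurable.integral_prod_right (f := fun t y : ℝ => Real.exp (t * id y)) ?_
  exact (by fun_prop : Measurable fun w : ℝ × ℝ => Real.exp (w.1 * id w.2)).stronglyMeasurable

lemma measurable_density (θ : Param p) : Measurable (M.density θ : FullData p → ℝ) := by
  have hY := measurable_cgf_id M.νY
  have hZ := measurable_cgf_id M.νZ
  unfold Model.density expFamDensity Model.predY Model.predZ
  fun_prop

lemma lintegral_expFamDensity (ν : Measure ℝ) (hν : ν ≠ 0) (φ η : ℝ)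
    (h : η / φ ∈ integrableExpSet id ν) :
    ∫⁻ y, ENNReal.ofReal (expFamDensity ν φ η y) ∂ν = 1 := by
  have hi : Integrable (fun y : ℝ => Real.exp (η / φ * id y)) ν := h
  have hpos : 0 < mgf id ν (η / φ) := mgf_pos' hν hi
  have he : ∀ y, expFamDensity ν φ η y = Real.exp (η / φ * id y) / mgf id ν (η / φ) := by
    intro y
    unfold expFamDensity cgf
    rw [Real.exp_sub, Real.exp_log hpos, mul_comm]
    rfl
  simp_rw [he]
  rw [← ofReal_integral_eq_lintegral_ofReal (hi.div_const _)
    (Filter.Eventually.of_forall fun y => by positivity), integral_div]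
  change ENNReal.ofReal (mgf id ν (η / φ) / mgf id ν (η / φ)) = 1
  rw [div_self hpos.ne', ENNReal.ofReal_one]

instance Model.Point.isProbabilityMeasure_law (P : M.Point p) :
    IsProbabilityMeasure P.law := by
  constructor
  have hm : Measurable fun d : FullData p => ENNReal.ofReal (M.density P.θ d) :=
    (measurable_density P.θ).ennreal_ofReal
  rw [Model.Point.law, withDensity_apply _ MeasurableSet.univ, Measure.restrict_univ,
    lintegral_prod _ hm.aemeasurable]
  have hY := Measure.ae_ae_of_ae_prod P.naturalY
  have key : ∀ᵐ xu ∂(P.lawX ⊗ₘ P.lawU),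
      ∫⁻ zy, ENNReal.ofReal (M.density P.θ (xu, zy)) ∂(M.νZ.prod M.νY) = 1 := by
    filter_upwards [P.naturalZ, hY] with xu hz hy
    have hm' : Measurable fun zy : ℝ × ℝ => ENNReal.ofReal (M.density P.θ (xu, zy)) :=
      hm.comp measurable_prodMk_left
    rw [lintegral_prod _ hm'.aemeasurable]
    rw [← lintegral_expFamDensity M.νZ M.νZ_ne_zero M.φZ (M.predZ P.θ xu)
      (interior_subset hz)]
    refine lintegral_congr_ae ?_
    filter_upwards [hy] with z hzy
    simp only [Model.density]
    have h0 : ∀ y, 0 ≤ expFamDensity M.νY M.φY (M.predY P.θ xu z) y :=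
      fun y => (Real.exp_pos _).le
    simp_rw [fun y => ENNReal.ofReal_mul (q := expFamDensity M.νZ M.φZ (M.predZ P.θ xu) z)
      (h0 y)]
    rw [lintegral_mul_const' _ _ ENNReal.ofReal_ne_top,
      lintegral_expFamDensity M.νY M.νY_ne_zero M.φY _ (interior_subset hzy), one_mul]
  rw [lintegral_congr_ae key]
  simp

/-- The full data score `S_θ(X, U, Z, Y)`: the gradient in `θ` of the log-likelihood. -/
def Model.Point.fullScore (P : M.Point p) (d : FullData p) : Param p :=
  gradient (fun ϑ : Param p => Real.log (M.density ϑ d)) P.θ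

/-! ### The information carried by `X`, by `(X, U)` and by `O = (X, Z, Y)` -/

/-- The σ-algebra generated by `X`. -/
abbrev sigmaX (p : ℕ) : MeasurableSpace (FullData p) :=
  MeasurableSpace.comap (fun d => d.1.1) inferInstance

/-- The σ-algebra generated by `(X, U)`. -/
abbrev sigmaXU (p : ℕ) : MeasurableSpace (FullData p) :=
  MeasurableSpace.comap (fun d => d.1) inferInstance

/-- The σ-algebra generated by the observed data `(X, Z, Y)`. -/
abbrev sigmaO (p : ℕ) : MeasurableSpace (FullData p) :=
  MeasurableSpace.comap (fun d => (d.1.1, d.2)) inferInstance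

lemma sigmaX_le (p : ℕ) :
    sigmaX p ≤ (Prod.instMeasurableSpace : MeasurableSpace (FullData p)) :=
  (by fun_prop : Measurable fun d : FullData p => d.1.1).comap_le

lemma sigmaXU_le (p : ℕ) :
    sigmaXU p ≤ (Prod.instMeasurableSpace : MeasurableSpace (FullData p)) :=
  (by fun_prop : Measurable fun d : FullData p => d.1).comap_le

lemma sigmaO_le (p : ℕ) :
    sigmaO p ≤ (Prod.instMeasurableSpace : MeasurableSpace (FullData p)) :=
  (by fun_prop : Measurable fun d : FullData p => (d.1.1, d.2)).comap_le

/-- The functions in `L²(μ)` that are (a.s. equal to) `m`-measurable functions. -/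
def measL2 {α : Type*} (F : Type*) [NormedAddCommGroup F] [InnerProductSpace ℝ F]
    (m : MeasurableSpace α) {m0 : MeasurableSpace α} (μ : Measure α) :
    Submodule ℝ (Lp F 2 μ) := lpMeas F ℝ m 2 μ

/-- Conditional expectation given `m`, as an operator on `L²(μ)`. -/
def condL2 {α F : Type*} [NormedAddCommGroup F] [InnerProductSpace ℝ F] [CompleteSpace F]
    {m m0 : MeasurableSpace α} (μ : Measure α) (hm : m ≤ m0) :
    Lp F 2 μ →L[ℝ] Lp F 2 μ :=
  (lpMeas F ℝ m 2 μ).subtypeL ∘L condExpL2 F ℝ hm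

/-- `condL2` is the usual conditional expectation. -/
lemma condL2_ae_eq {α F : Type*} [NormedAddCommGroup F] [InnerProductSpace ℝ F]
    [CompleteSpace F] {m m0 : MeasurableSpace α} (μ : Measure α) [IsFiniteMeasure μ]
    (hm : m ≤ m0) (f : Lp F 2 μ) :
    (condL2 μ hm f : α → F) =ᵐ[μ] μ[(f : α → F) | m] := by
  have h := (Lp.memLp f).condExpL2_ae_eq_condExp (𝕜 := ℝ) hm
  rwa [Lp.toLp_coeFn] at h

/-! ### Hilbert space geometry

`Lp (Param p) 2 P.law` is the space of `q`-dimensional square integrable functions of the full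
data, with inner product `E[hᵀ g]`. -/

/-- `L²` functions of the full data with values in `ℝ^q`. -/
abbrev Model.Point.L2 (P : M.Point p) : Type := Lp (Param p) 2 P.law

/-- The `σ(X, U)`-measurable elements of `L²`. -/
def Model.Point.L2XU (P : M.Point p) : Submodule ℝ P.L2 :=
  measL2 (Param p) (sigmaXU p) P.law

/-- The `σ(X)`-measurable elements of `L²`. -/
def Model.Point.L2X (P : M.Point p) : Submodule ℝ P.L2 :=
  measL2 (Param p) (sigmaX p) P.law

/-- The space `L²(X, Z, Y)` of observed data functions. -/
def Model.Point.L2O (P : M.Point p) : Submodule ℝ P.L2 :=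
  measL2 (Param p) (sigmaO p) P.law

/-- The Hilbert space `H` of mean zero functions. -/
def Model.Point.meanZero (P : M.Point p) : Submodule ℝ P.L2 where
  carrier := {h | ∫ d, h d ∂P.law = 0}
  zero_mem' := by
    change ∫ d, (0 : P.L2) d ∂P.law = 0
    rw [integral_congr_ae (Lp.coeFn_zero _ _ _)]
    simp
  add_mem' := by
    intro f g (hf : ∫ d, f d ∂P.law = 0) (hg : ∫ d, g d ∂P.law = 0)
    change ∫ d, (f + g : P.L2) d ∂P.law = 0
    rw [integral_congr_ae (Lp.coeFn_add f g)]
    simp only [Pi.add_apply]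
    rw [integral_add ((Lp.memLp f).integrable (by norm_num))
      ((Lp.memLp g).integrable (by norm_num)), hf, hg, add_zero]
  smul_mem' := by
    intro c f (hf : ∫ d, f d ∂P.law = 0)
    change ∫ d, (c • f : P.L2) d ∂P.law = 0
    rw [integral_congr_ae (Lp.coeFn_smul c f)]
    simp only [Pi.smul_apply]
    rw [integral_smul, hf, smul_zero]

/-- `E[· ∣ X]` on `L²`. -/
def Model.Point.condX (P : M.Point p) : P.L2 →L[ℝ] P.L2 := condL2 P.law (sigmaX_le p)

/-- `E[· ∣ X, U]` on `L²`. -/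
def Model.Point.condXU (P : M.Point p) : P.L2 →L[ℝ] P.L2 := condL2 P.law (sigmaXU_le p)

/-- `E[· ∣ X, Z, Y]` on `L²`. -/
def Model.Point.condO (P : M.Point p) : P.L2 →L[ℝ] P.L2 := condL2 P.law (sigmaO_le p)

/-- `Λ₁ᶠ = {a₁(X) ∈ L² : E[a₁(X)] = 0}`. -/
def Model.Point.nuisF1 (P : M.Point p) : Submodule ℝ P.L2 :=
  P.L2X ⊓ P.meanZero

/-- `Λ₂ᶠ = {a₂(U, X) ∈ L² : E[a₂(U, X) ∣ X] = 0}`. -/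
def Model.Point.nuisF2 (P : M.Point p) : Submodule ℝ P.L2 :=
  P.L2XU ⊓ LinearMap.ker P.condX.toLinearMap

/-- `Λ₁ = E[Λ₁ᶠ ∣ X, Z, Y]`. -/
def Model.Point.nuis1 (P : M.Point p) : Submodule ℝ P.L2 :=
  P.nuisF1.map P.condO.toLinearMap

/-- `Λ₂ = E[Λ₂ᶠ ∣ X, Z, Y]`. -/
def Model.Point.nuis2 (P : M.Point p) : Submodule ℝ P.L2 :=
  P.nuisF2.map P.condO.toLinearMap

/-- The observed data nuisance tangent space: the mean square closure of `Λ₁ ⊕ Λ₂`. -/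
def Model.Point.nuis (P : M.Point p) : Submodule ℝ P.L2 :=
  (P.nuis1 ⊔ P.nuis2).topologicalClosure

instance Model.Point.hasOrthogonalProjection_nuis (P : M.Point p) :
    P.nuis.HasOrthogonalProjection := by
  unfold Model.Point.nuis
  infer_instance

/-- `Π[h ∣ Λ]`. -/
def Model.Point.proj (P : M.Point p) (h : P.L2) : P.L2 := P.nuis.starProjection h

/-- The observed data score `E[S_θ(X, U, Z, Y) ∣ X, Z, Y]`. -/
def Model.Point.obsScore (P : M.Point p) (hS : MemLp P.fullScore 2 P.law) : P.L2 :=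
  P.condO hS.toLp

/-- The efficient score: the residual of the observed data score after projection on the
nuisance tangent space. -/
def Model.Point.effScore (P : M.Point p) (hS : MemLp P.fullScore 2 P.law) : P.L2 :=
  P.obsScore hS - P.proj (P.obsScore hS)

/-- The matrix `E[g hᵀ]`. -/
def Model.Point.crossMoment (P : M.Point p) (g h : P.L2) :
    Matrix (ParamIdx p) (ParamIdx p) ℝ :=
  Matrix.of fun i j => ∫ d, g d i * h d j ∂P.law

/-- `B` is the least element of `S` for the Loewner order. -/
def IsLoewnerLeast {ι : Type*} [Fintype ι] (S : Set (Matrix ι ι ℝ)) (B : Matrix ι ι ℝ) : Prop :=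
  B ∈ S ∧ ∀ A ∈ S, (A - B).PosSemidef

/-- Observed data influence functions for `θ`: mean zero square integrable functions of
`(X, Z, Y)`, orthogonal to the nuisance tangent space, with `E[φ S_θᵀ] = I`. -/
def Model.Point.IsInfluence (P : M.Point p) (hS : MemLp P.fullScore 2 P.law) (φ : P.L2) : Prop :=
  φ ∈ P.L2O ∧ φ ∈ P.meanZero ∧ φ ∈ P.nuisᗮ ∧
    P.crossMoment φ (P.obsScore hS) = 1

/-- `B` is the semiparametric information bound: the least information `E[(S - g)(S - g)ᵀ]`
for `θ` when the observed data score `S` is perturbed by elements `g` of the nuisance tangent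
space. -/
def Model.Point.IsInformationBound (P : M.Point p) (hS : MemLp P.fullScore 2 P.law)
    (B : Matrix (ParamIdx p) (ParamIdx p) ℝ) : Prop :=
  IsLoewnerLeast {A | ∃ g ∈ P.nuis,
    A = P.crossMoment (P.obsScore hS - g) (P.obsScore hS - g)} B

/-- `φ` is the efficient influence function: an influence function whose variance is no larger
than that of any other one. -/
def Model.Point.IsEfficientInfluence (P : M.Point p) (hS : MemLp P.fullScore 2 P.law)
    (φ : P.L2) : Prop :=
  P.IsInfluence hS φ ∧ IsLoewnerLeast {A | ∃ ψ, P.IsInfluence hS ψ ∧ A = P.crossMoment ψ ψ}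
    (P.crossMoment φ φ)

/-- `B` is the semiparametric efficiency (variance) bound: the variance of the efficient
influence function. -/
def Model.Point.IsVarianceBound (P : M.Point p) (hS : MemLp P.fullScore 2 P.law)
    (B : Matrix (ParamIdx p) (ParamIdx p) ℝ) : Prop :=
  ∃ φ, P.IsEfficientInfluence hS φ ∧ B = P.crossMoment φ φ

end Sensitivity

end

noncomputable section
namespace Sensitivity

/-! Everything happens in the Hilbert space $L^2$, where conditional expectations are self-adjoint
projections. Since $\Lambda_1\oplus\Lambda_2$ is the image under $\mathbb E[\cdot\mid X,Z,Y]$ of the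
mean-zero functions of $(X,U)$ (`nuis1_sup_nuis2`), self-adjointness shows that a mean-zero observed
function $r$ is orthogonal to $\Lambda$ exactly when $\mathbb E[r\mid X,U]=0$
(`mem_orthogonal_nuis_iff`). Applied to $r=S_\theta-\mathbb E[a\mid X,Z,Y]$, this is the integral
equation.

The model enters only through $\mathbb E[S_\theta(X,U,Z,Y)\mid X,U]=0$ (`condExp_fullScore`), the
mean-zero property of exponential family scores. It gives $\mathbb E[S_\theta(X,Z,Y)\mid X]=0$,
which forces $\mathbb E[a\mid X]=0$ for every mean-zero solution $a(U,X)$ of the equation.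

For the bounds, $\Lambda$ is stable under constant matrices (`matAct_mem_nuis`), so $g\perp\Lambda$
gives the matrix identity $\mathbb E[gh^T]=0$ for $h\in\Lambda$ (`crossMoment_eq_zero`), not only
its trace. Both optimality claims are then Pythagoras in matrix form. -/

/-! ### Exponential families: total mass and mean of the score. -/

lemma expFamDensity_eq_div {ν : Measure ℝ} (hν : ν ≠ 0) {φ η : ℝ}
    (h : η / φ ∈ integrableExpSet id ν) (y : ℝ) :
    expFamDensity ν φ η y = Real.exp (η / φ * y) / mgf id ν (η / φ) := by
  have hi : Integrable (fun y : ℝ => Real.exp (η / φ * id y)) ν := h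
  unfold expFamDensity cgf
  rw [Real.exp_sub, Real.exp_log (mgf_pos' hν hi), mul_comm]

lemma integral_expFamDensity {ν : Measure ℝ} (hν : ν ≠ 0) {φ η : ℝ}
    (h : η / φ ∈ integrableExpSet id ν) : ∫ y, expFamDensity ν φ η y ∂ν = 1 := by
  have hi : Integrable (fun y : ℝ => Real.exp (η / φ * id y)) ν := h
  simp_rw [expFamDensity_eq_div hν h]
  rw [integral_div]
  exact div_self (mgf_pos' hν hi).ne'

/-- The score of an exponential family in its natural parameter has mean zero. -/
lemma integral_expFamDensity_mul_sub {ν : Measure ℝ} (hν : ν ≠ 0) {φ η : ℝ}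
    (h : η / φ ∈ interior (integrableExpSet id ν)) :
    ∫ y, expFamDensity ν φ η y * (y - deriv (cgf id ν) (η / φ)) ∂ν = 0 := by
  have h' := interior_subset h
  have hi : Integrable (fun y : ℝ => Real.exp (η / φ * y)) ν := h'
  have hm : mgf id ν (η / φ) ≠ 0 := (mgf_pos' hν (X := id) hi).ne'
  have hi1 : Integrable (fun y : ℝ => y * Real.exp (η / φ * y)) ν := by
    simpa using integrable_pow_mul_exp_of_mem_interior_integrableExpSet h 1
  have hd : deriv (cgf id ν) (η / φ) =
      (∫ y, y * Real.exp (η / φ * y) ∂ν) / mgf id ν (η / φ) := deriv_cgf h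
  have he : ∀ y, expFamDensity ν φ η y * (y - deriv (cgf id ν) (η / φ)) =
      y * Real.exp (η / φ * y) / mgf id ν (η / φ) -
        Real.exp (η / φ * y) / mgf id ν (η / φ) * deriv (cgf id ν) (η / φ) := by
    intro y
    rw [expFamDensity_eq_div hν h']
    ring
  simp_rw [he]
  rw [integral_sub (hi1.div_const _) ((hi.div_const _).mul_const _), integral_div,
    integral_mul_const, integral_div, ← hd]
  change _ - mgf id ν (η / φ) / mgf id ν (η / φ) * _ = 0
  rw [div_self hm]
  ring

/-! ### The full data score and its conditional mean given $(X,U)$. -/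

variable {p : ℕ} {M : Model}

/-- The gradient in `θ` of the linear predictor of the outcome model. -/
def designY (x : Covariate p) (z : ℝ) : Param p :=
  WithLp.toLp 2 (Sum.elim (fun j => x j) (Sum.elim (fun _ => z) fun _ => 0))

/-- The gradient in `θ` of the linear predictor of the propensity score model. -/
def designZ (x : Covariate p) : Param p :=
  WithLp.toLp 2 (Sum.elim (fun _ => 0) (Sum.elim (fun _ => 0) fun j => x j))

lemma predY_eq (θ : Param p) (xu : Covariate p × ℝ) (z : ℝ) :
    M.predY θ xu z = ⟪designY xu.1 z, θ⟫_ℝ + M.δ * xu.2 := by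
  simp [Model.predY, designY, PiLp.inner_apply, Fintype.sum_sum_type, add_assoc]

lemma predZ_eq (θ : Param p) (xu : Covariate p × ℝ) :
    M.predZ θ xu = ⟪designZ xu.1, θ⟫_ℝ + M.γ * xu.2 := by
  simp [Model.predZ, designZ, PiLp.inner_apply, Fintype.sum_sum_type]

/-- Valid for every `θ`, natural or not, because the density is a product of exponentials; hence it
can be rewritten under the gradient. -/
lemma log_density (θ : Param p) (d : FullData p) :
    Real.log (M.density θ d) =
      (d.2.2 * (M.predY θ d.1 d.2.1 / M.φY) - cgf id M.νY (M.predY θ d.1 d.2.1 / M.φY)) +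
      (d.2.1 * (M.predZ θ d.1 / M.φZ) - cgf id M.νZ (M.predZ θ d.1 / M.φZ)) := by
  unfold Model.density expFamDensity
  rw [← Real.exp_add, Real.log_exp]

/-- The chain rule, with `cgf` analytic in the interior of the natural parameter space. -/
lemma hasGradientAt_logLik {ν : Measure ℝ} {φ c y : ℝ} {v θ : Param p}
    (h : (⟪v, θ⟫_ℝ + c) / φ ∈ interior (integrableExpSet id ν)) :
    HasGradientAt (fun ϑ : Param p =>
        y * ((⟪v, ϑ⟫_ℝ + c) / φ) - cgf id ν ((⟪v, ϑ⟫_ℝ + c) / φ))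
      (((y - deriv (cgf id ν) ((⟪v, θ⟫_ℝ + c) / φ)) / φ) • v) θ := by
  rw [hasGradientAt_iff_hasFDerivAt]
  have h1 : HasFDerivAt (fun ϑ : Param p => (⟪v, ϑ⟫_ℝ + c) / φ) (φ⁻¹ • innerSL ℝ v) θ := by
    simp_rw [div_eq_inv_mul]
    exact (((innerSL ℝ v).hasFDerivAt (x := θ)).add_const c).const_mul φ⁻¹
  have h2 := (analyticAt_cgf h).differentiableAt.hasDerivAt.comp_hasFDerivAt θ h1
  refine ((h1.const_mul y).sub h2).congr_fderiv ?_
  ext w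
  simp
  ring

/-- The full data score at a point where both natural parameters are interior. -/
lemma fullScore_eq (P : M.Point p) (d : FullData p)
    (hZ : M.predZ P.θ d.1 / M.φZ ∈ interior (integrableExpSet id M.νZ))
    (hY : M.predY P.θ d.1 d.2.1 / M.φY ∈ interior (integrableExpSet id M.νY)) :
    P.fullScore d =
      ((d.2.2 - deriv (cgf id M.νY) (M.predY P.θ d.1 d.2.1 / M.φY)) / M.φY) •
        designY d.1.1 d.2.1 +
      ((d.2.1 - deriv (cgf id M.νZ) (M.predZ P.θ d.1 / M.φZ)) / M.φZ) • designZ d.1.1 := by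
  unfold Model.Point.fullScore
  simp_rw [log_density, predY_eq, predZ_eq] at *
  refine HasGradientAt.gradient ?_
  have h1 := hasGradientAt_logLik (y := d.2.2) hY
  have h2 := hasGradientAt_logLik (y := d.2.1) hZ
  rw [hasGradientAt_iff_hasFDerivAt] at *
  rw [map_add]
  exact h1.add h2

lemma density_nonneg (θ : Param p) (d : FullData p) : 0 ≤ M.density θ d :=
  mul_nonneg (Real.exp_pos _).le (Real.exp_pos _).le

lemma integrable_law_iff (P : M.Point p) {f : FullData p → ℝ} :
    Integrable f P.law ↔ Integrable (fun d => M.density P.θ d * f d)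
      ((P.lawX ⊗ₘ P.lawU).prod (M.νZ.prod M.νY)) := by
  unfold Model.Point.law
  rw [integrable_withDensity_iff_integrable_smul' (measurable_density P.θ).ennreal_ofReal
    (Filter.Eventually.of_forall fun _ => ENNReal.ofReal_lt_top)]
  simp_rw [ENNReal.toReal_ofReal (density_nonneg _ _), smul_eq_mul]

lemma integral_law (P : M.Point p) (f : FullData p → ℝ) :
    ∫ d, f d ∂P.law = ∫ d, M.density P.θ d * f d
      ∂((P.lawX ⊗ₘ P.lawU).prod (M.νZ.prod M.νY)) := by
  unfold Model.Point.law
  rw [integral_withDensity_eq_integral_toReal_smul (measurable_density P.θ).ennreal_ofReal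
    (Filter.Eventually.of_forall fun _ => ENNReal.ofReal_lt_top)]
  simp_rw [ENNReal.toReal_ofReal (density_nonneg _ _), smul_eq_mul]

/-- Each coordinate of the full data score integrates to zero given `(X, U)`. -/
lemma integral_density_mul_fullScore (P : M.Point p) (i : ParamIdx p) (xu : Covariate p × ℝ)
    (hZ : M.predZ P.θ xu / M.φZ ∈ interior (integrableExpSet id M.νZ))
    (hY : ∀ᵐ z ∂M.νZ, M.predY P.θ xu z / M.φY ∈ interior (integrableExpSet id M.νY))
    (hi : Integrable (fun zy => M.density P.θ (xu, zy) * P.fullScore (xu, zy) i)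
      (M.νZ.prod M.νY)) :
    ∫ zy, M.density P.θ (xu, zy) * P.fullScore (xu, zy) i ∂(M.νZ.prod M.νY) = 0 := by
  rw [integral_prod _ hi]
  set fZ := expFamDensity M.νZ M.φZ (M.predZ P.θ xu)
  set b := deriv (cgf id M.νZ) (M.predZ P.θ xu / M.φZ)
  -- Integrating over `y` first removes the outcome part of the score and leaves a multiple of the
  -- score of `Z`, which then integrates to zero over `z`.
  have key : ∀ᵐ z ∂M.νZ, ∫ y, M.density P.θ (xu, (z, y)) * P.fullScore (xu, (z, y)) i ∂M.νY =
      fZ z * (z - b) * (designZ xu.1 i / M.φZ) := by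
    filter_upwards [hY] with z hz
    set fY := expFamDensity M.νY M.φY (M.predY P.θ xu z)
    set a := deriv (cgf id M.νY) (M.predY P.θ xu z / M.φY)
    have h0 : ∫ y, fY y * (y - a) ∂M.νY = 0 :=
      integral_expFamDensity_mul_sub M.νY_ne_zero hz
    have h1 : ∫ y, fY y ∂M.νY = 1 :=
      integral_expFamDensity M.νY_ne_zero (interior_subset hz)
    -- A non-integrable function would have integral `0` by convention, not `1`.
    have hfi : Integrable fY M.νY := by
      by_contra hn
      rw [integral_undef hn] at h1
      exact zero_ne_one h1
    have hfi1 : Integrable (fun y => fY y * (y - a)) M.νY := by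
      have hy : Integrable (fun y : ℝ => y * Real.exp (M.predY P.θ xu z / M.φY * y)) M.νY := by
        simpa using integrable_pow_mul_exp_of_mem_interior_integrableExpSet hz 1
      refine ((hy.div_const (mgf id M.νY (M.predY P.θ xu z / M.φY))).sub
        (hfi.mul_const a)).congr (Filter.Eventually.of_forall fun y => ?_)
      simp only [fY, Pi.sub_apply, expFamDensity_eq_div M.νY_ne_zero (interior_subset hz)]
      ring
    have he : ∀ y, M.density P.θ (xu, (z, y)) * P.fullScore (xu, (z, y)) i =
        fY y * (y - a) * (fZ z * designY xu.1 z i / M.φY) +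
          fY y * (fZ z * (z - b) * (designZ xu.1 i / M.φZ)) := by
      intro y
      rw [fullScore_eq P (xu, (z, y)) hZ hz]
      simp only [Model.density, PiLp.add_apply, PiLp.smul_apply, smul_eq_mul]
      ring
    simp_rw [he]
    rw [integral_add (hfi1.mul_const _) (hfi.mul_const _), integral_mul_const,
      integral_mul_const, h0, h1]
    ring
  rw [integral_congr_ae key, integral_mul_const,
    integral_expFamDensity_mul_sub M.νZ_ne_zero hZ, zero_mul]

/-- The full data score has conditional mean zero given `(X, U)`. -/
lemma condExp_fullScore (P : M.Point p) (hS : Integrable P.fullScore P.law) :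
    P.law[P.fullScore | sigmaXU p] =ᵐ[P.law] 0 := by
  refine (ae_eq_condExp_of_forall_setIntegral_eq (sigmaXU_le p) hS
    (fun s _ _ => integrableOn_zero) ?_ aestronglyMeasurable_zero).symm
  rintro s ⟨t, ht, rfl⟩ -
  have hs : MeasurableSet ((fun d : FullData p => d.1) ⁻¹' t) := measurable_fst ht
  simp only [integral_zero]
  ext i
  rw [eval_integral_piLp fun j => (hS.eval_piLp j).integrableOn, ← integral_indicator hs,
    integral_law]
  have hSi : Integrable (fun d => P.fullScore d i) P.law := hS.eval_piLp i
  have hint := (integrable_law_iff P).1 (hSi.indicator hs)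
  rw [integral_prod _ hint]
  symm
  -- An event of `sigmaXU` constrains `xu` only, so for fixed `xu` the inner integral is either the
  -- full integral of the score or that of `0`.
  refine integral_eq_zero_of_ae ?_
  filter_upwards [P.naturalZ, Measure.ae_ae_of_ae_prod P.naturalY,
    ((integrable_law_iff P).1 hSi).prod_right_ae] with xu hZ hY hi
  by_cases hxu : xu ∈ t
  · simpa [Set.indicator, hxu] using integral_density_mul_fullScore P i xu hZ hY hi
  · simp [Set.indicator, hxu]


/-! ### Conditional expectation as an orthogonal projection of $L^2$. -/

section CondL2
variable {α F : Type*} [NormedAddCommGroup F] [InnerProductSpace ℝ F]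
  {m m₁ m₂ m0 : MeasurableSpace α} {μ : Measure α}

lemma measL2_mono (h₁₂ : m₁ ≤ m₂) : measL2 F m₁ μ ≤ measL2 F m₂ μ :=
  fun _ hf => AEStronglyMeasurable.mono h₁₂ hf

lemma compLpL_mem_measL2 {L : F →L[ℝ] F} {f : Lp F 2 μ} (hf : f ∈ measL2 F m μ) :
    L.compLpL 2 μ f ∈ measL2 F m μ :=
  (L.continuous.comp_aestronglyMeasurable
    (hf : AEStronglyMeasurable[m] f μ)).congr (L.coeFn_compLpL f).symm

variable [CompleteSpace F]

lemma condL2_mem (hm : m ≤ m0) (f : Lp F 2 μ) : condL2 μ hm f ∈ measL2 F m μ :=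
  (condExpL2 F ℝ hm f).2

lemma inner_condL2_left (hm : m ≤ m0) (f g : Lp F 2 μ) :
    ⟪condL2 μ hm f, g⟫_ℝ = ⟪f, condL2 μ hm g⟫_ℝ :=
  inner_condExpL2_left_eq_right hm

lemma condL2_of_mem (hm : m ≤ m0) {f : Lp F 2 μ} (hf : f ∈ measL2 F m μ) :
    condL2 μ hm f = f := by
  have : Fact (m ≤ m0) := ⟨hm⟩
  exact Submodule.starProjection_eq_self_iff.2 hf

lemma inner_condL2_left_of_mem (hm : m ≤ m0) (f : Lp F 2 μ) {g : Lp F 2 μ}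
    (hg : g ∈ measL2 F m μ) : ⟪condL2 μ hm f, g⟫_ℝ = ⟪f, g⟫_ℝ := by
  rw [inner_condL2_left, condL2_of_mem hm hg]

/-- For the converse, test against the projection of `f` itself. -/
lemma condL2_eq_zero_iff (hm : m ≤ m0) {f : Lp F 2 μ} :
    condL2 μ hm f = 0 ↔ ∀ g ∈ measL2 F m μ, ⟪f, g⟫_ℝ = 0 := by
  refine ⟨fun h g hg => ?_, fun h => ?_⟩
  · rw [← inner_condL2_left_of_mem hm f hg, h, inner_zero_left]
  · rw [← inner_self_eq_zero (𝕜 := ℝ), inner_condL2_left_of_mem hm f (condL2_mem hm f)]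
    exact h _ (condL2_mem hm f)

/-- The tower property. -/
lemma condL2_condL2 (h₁ : m₁ ≤ m0) (h₂ : m₂ ≤ m0) (h₁₂ : m₁ ≤ m₂) (f : Lp F 2 μ) :
    condL2 μ h₁ (condL2 μ h₂ f) = condL2 μ h₁ f := by
  rw [← sub_eq_zero, ← map_sub, condL2_eq_zero_iff]
  intro g hg
  rw [inner_sub_left, inner_condL2_left_of_mem h₂ f (measL2_mono h₁₂ hg), sub_self]

lemma isClosed_measL2 (hm : m ≤ m0) : IsClosed (measL2 F m μ : Set (Lp F 2 μ)) := by
  have : (measL2 F m μ : Set (Lp F 2 μ)) = {f | condL2 μ hm f = f} := by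
    ext f
    exact ⟨condL2_of_mem hm, fun h => h ▸ condL2_mem hm f⟩
  rw [this]
  exact isClosed_eq (condL2 μ hm).continuous continuous_id

lemma condL2_compLpL [IsFiniteMeasure μ] (hm : m ≤ m0) (L : F →L[ℝ] F) (f : Lp F 2 μ) :
    condL2 μ hm (L.compLpL 2 μ f) = L.compLpL 2 μ (condL2 μ hm f) := by
  refine Lp.ext ?_
  have h1 := L.comp_condExp_comm (m := m) ((Lp.memLp f).integrable (by norm_num))
  filter_upwards [condL2_ae_eq μ hm (L.compLpL 2 μ f), condL2_ae_eq μ hm f,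
    L.coeFn_compLpL (condL2 μ hm f), h1,
    condExp_congr_ae (m := m) (L.coeFn_compLpL (p := 2) (μ := μ) f)] with d h2 h3 h4 h5 h6
  rw [h2, h4, h3, h6]
  exact h5.symm

end CondL2

/-! ### Geometry of the nuisance tangent space. -/

variable (P : M.Point p)

lemma sigmaX_le_sigmaXU (p : ℕ) : sigmaX p ≤ sigmaXU p := by
  rintro _ ⟨t, ht, rfl⟩
  exact ⟨Prod.fst ⁻¹' t, measurable_fst ht, rfl⟩

lemma sigmaX_le_sigmaO (p : ℕ) : sigmaX p ≤ sigmaO p := by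
  rintro _ ⟨t, ht, rfl⟩
  exact ⟨Prod.fst ⁻¹' t, measurable_fst ht, rfl⟩

/-- The constant functions in `L²`. -/
def Model.Point.constL2 (c : Param p) : P.L2 :=
  indicatorConstLp 2 MeasurableSet.univ (measure_ne_top P.law _) c

lemma constL2_mem_L2X (c : Param p) : P.constL2 c ∈ P.L2X :=
  mem_lpMeas_indicatorConstLp (sigmaX_le p) (MeasurableSet.univ) (measure_ne_top P.law _)

lemma inner_constL2 (c : Param p) (f : P.L2) : ⟪P.constL2 c, f⟫_ℝ = ⟪c, ∫ d, f d ∂P.law⟫_ℝ := by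
  unfold Model.Point.constL2
  rw [L2.inner_indicatorConstLp_eq_inner_setIntegral, Measure.restrict_univ]

/-- Recasting mean zero as orthogonality to constants yields both closedness and compatibility with
conditioning. -/
lemma mem_meanZero_iff {f : P.L2} : f ∈ P.meanZero ↔ ∀ c, ⟪P.constL2 c, f⟫_ℝ = 0 := by
  simp_rw [inner_constL2]
  refine ⟨fun (h : ∫ d, f d ∂P.law = 0) c => by rw [h, inner_zero_right], fun h => ?_⟩
  exact inner_self_eq_zero.1 (h (∫ d, f d ∂P.law))

lemma isClosed_meanZero : IsClosed (P.meanZero : Set P.L2) := by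
  have : (P.meanZero : Set P.L2) = ⋂ c, {f | ⟪P.constL2 c, f⟫_ℝ = 0} := by
    ext f
    simpa using mem_meanZero_iff P
  rw [this]
  exact isClosed_iInter fun c => isClosed_eq (by fun_prop) continuous_const

lemma condX_mem_meanZero_iff {f : P.L2} : P.condX f ∈ P.meanZero ↔ f ∈ P.meanZero := by
  simp_rw [mem_meanZero_iff]
  refine forall_congr' fun c => ?_
  rw [real_inner_comm, real_inner_comm f, Model.Point.condX,
    inner_condL2_left_of_mem _ _ (constL2_mem_L2X P c)]

lemma condX_condO (f : P.L2) : P.condX (P.condO f) = P.condX f :=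
  condL2_condL2 _ _ (sigmaX_le_sigmaO p) f

lemma condX_condXU (f : P.L2) : P.condX (P.condXU f) = P.condX f :=
  condL2_condL2 _ _ (sigmaX_le_sigmaXU p) f

lemma condO_mem_meanZero_iff {f : P.L2} : P.condO f ∈ P.meanZero ↔ f ∈ P.meanZero := by
  rw [← condX_mem_meanZero_iff, condX_condO, condX_mem_meanZero_iff]

/-- The splitting is $t=\mathbb E[t\mid X]+(t-\mathbb E[t\mid X])$. -/
lemma nuisF1_sup_nuisF2 : P.nuisF1 ⊔ P.nuisF2 = P.L2XU ⊓ P.meanZero := by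
  refine le_antisymm (sup_le ?_ ?_) ?_
  · exact inf_le_inf_right _ (measL2_mono (sigmaX_le_sigmaXU p))
  · refine le_inf inf_le_left fun b hb => ?_
    rw [← condX_mem_meanZero_iff, show P.condX b = 0 from hb.2]
    exact zero_mem _
  · rintro t ⟨ht, ht0⟩
    rw [← add_sub_cancel (P.condX t) t]
    have hX : P.condX t ∈ P.L2X := condL2_mem _ t
    refine Submodule.add_mem_sup ⟨hX, (condX_mem_meanZero_iff P).2 ht0⟩
      ⟨sub_mem ht (measL2_mono (sigmaX_le_sigmaXU p) hX), ?_⟩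
    change P.condX (t - P.condX t) = 0
    rw [map_sub, sub_eq_zero]
    exact (condL2_of_mem _ hX).symm

lemma nuis1_sup_nuis2 :
    P.nuis1 ⊔ P.nuis2 = (P.L2XU ⊓ P.meanZero).map P.condO.toLinearMap := by
  rw [← nuisF1_sup_nuisF2, Submodule.map_sup]
  rfl

lemma nuis_le_L2O : P.nuis ≤ P.L2O := by
  refine Submodule.topologicalClosure_minimal _ ?_ (isClosed_measL2 (sigmaO_le p))
  rw [nuis1_sup_nuis2]
  rintro _ ⟨b, -, rfl⟩
  exact condL2_mem _ b

lemma nuis_le_meanZero : P.nuis ≤ P.meanZero := by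
  refine Submodule.topologicalClosure_minimal _ ?_ (isClosed_meanZero P)
  rw [nuis1_sup_nuis2]
  rintro _ ⟨b, hb, rfl⟩
  exact (condO_mem_meanZero_iff P).2 hb.2

lemma proj_mem (h : P.L2) : P.proj h ∈ P.nuis := Submodule.starProjection_apply_mem _ _

lemma sub_proj_mem (h : P.L2) : h - P.proj h ∈ P.nuisᗮ :=
  Submodule.sub_starProjection_mem_orthogonal h

lemma proj_eq_zero {h : P.L2} (hh : h ∈ P.nuisᗮ) : P.proj h = 0 :=
  (Submodule.starProjection_apply_eq_zero_iff _).2 hh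

lemma proj_eq_iff {h g : P.L2} (hg : g ∈ P.nuis) : P.proj h = g ↔ h - g ∈ P.nuisᗮ := by
  refine ⟨fun e => e ▸ sub_proj_mem P h, fun e => ?_⟩
  exact (Submodule.eq_starProjection_of_mem_orthogonal hg e)

/-- A mean zero observed data function is orthogonal to the nuisance tangent space if and only
if its conditional expectation given `(X, U)` vanishes. -/
lemma mem_orthogonal_nuis_iff {r : P.L2} (hO : r ∈ P.L2O) (h0 : r ∈ P.meanZero) :
    r ∈ P.nuisᗮ ↔ P.condXU r = 0 := by
  have hr : ∀ b, ⟪P.condO b, r⟫_ℝ = ⟪b, r⟫_ℝ := fun b => inner_condL2_left_of_mem _ b hO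
  rw [Model.Point.nuis, Submodule.orthogonal_closure, nuis1_sup_nuis2]
  constructor
  · intro h
    have hXU : P.condXU r ∈ P.L2XU := condL2_mem _ r
    have hm : P.condXU r ∈ P.meanZero := by
      rwa [← condX_mem_meanZero_iff, condX_condXU, condX_mem_meanZero_iff]
    -- The direction tested is $b=\mathbb E[r\mid X,U]$, admissible because `r` has mean zero; the
    -- pairing equals $\|b\|^2$.
    have h1 : ⟪P.condXU r, r⟫_ℝ = 0 := by
      rw [← hr]
      exact h _ ⟨_, ⟨hXU, hm⟩, rfl⟩
    have h2 : ⟪P.condXU r, P.condXU r⟫_ℝ = ⟪r, P.condXU r⟫_ℝ :=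
      inner_condL2_left_of_mem _ r hXU
    rw [← inner_self_eq_zero (𝕜 := ℝ), h2, real_inner_comm, h1]
  · rintro h _ ⟨b, hb, rfl⟩
    change ⟪P.condO b, r⟫_ℝ = 0
    rw [hr, real_inner_comm]
    exact (condL2_eq_zero_iff _).1 h b hb.1

/-! ### The observed score and the integral equation. -/

variable (hS : MemLp P.fullScore 2 P.law)

lemma condXU_fullScore : P.condXU hS.toLp = 0 := by
  refine Lp.ext ?_
  have h := condExp_congr_ae (m := sigmaXU p) hS.coeFn_toLp
  exact (condL2_ae_eq _ _ _).trans (h.trans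
    ((condExp_fullScore P (hS.integrable (by norm_num))).trans (Lp.coeFn_zero _ _ _).symm))

lemma obsScore_mem_L2O : P.obsScore hS ∈ P.L2O := condL2_mem _ _

lemma condX_obsScore : P.condX (P.obsScore hS) = 0 := by
  rw [Model.Point.obsScore, condX_condO, ← condX_condXU, condXU_fullScore, map_zero]

lemma obsScore_mem_meanZero : P.obsScore hS ∈ P.meanZero := by
  rw [← condX_mem_meanZero_iff, condX_obsScore]
  exact zero_mem _

lemma mem_meanZero_of_condX_eq_zero {a : P.L2} (ha : P.condX a = 0) : a ∈ P.meanZero := by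
  rw [← condX_mem_meanZero_iff, ha]
  exact zero_mem _

lemma condO_mem_nuis_sup {a : P.L2} (ha : a ∈ P.L2XU) (h0 : a ∈ P.meanZero) :
    P.condO a ∈ P.nuis1 ⊔ P.nuis2 := by
  rw [nuis1_sup_nuis2]
  exact ⟨a, ⟨ha, h0⟩, rfl⟩

/-- Only mean zero of `a` is required, so that the lemma also applies to a preimage of the
projection before $\mathbb E[a\mid X]=0$ is known. -/
lemma condXU_obsScore_eq_iff {a : P.L2} (ha : a ∈ P.L2XU) (h0 : a ∈ P.meanZero) :
    P.condXU (P.obsScore hS) = P.condXU (P.condO a) ↔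
      P.proj (P.obsScore hS) = P.condO a := by
  have hsup := condO_mem_nuis_sup P ha h0
  have hn : P.condO a ∈ P.nuis := Submodule.le_topologicalClosure _ hsup
  rw [proj_eq_iff P hn, mem_orthogonal_nuis_iff P
    (sub_mem (obsScore_mem_L2O P hS) (nuis_le_L2O P hn))
    (sub_mem (obsScore_mem_meanZero P hS) (nuis_le_meanZero P hn)), map_sub, sub_eq_zero]

lemma exists_condXU_eq_iff :
    (∃ a ∈ P.L2XU, P.condX a = 0 ∧ P.condXU (P.obsScore hS) = P.condXU (P.condO a)) ↔
      P.proj (P.obsScore hS) ∈ P.nuis1 ⊔ P.nuis2 := by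
  constructor
  · rintro ⟨a, ha, h0, h⟩
    have h0' := mem_meanZero_of_condX_eq_zero P h0
    rw [(condXU_obsScore_eq_iff P hS ha h0').1 h]
    exact condO_mem_nuis_sup P ha h0'
  · intro h
    rw [nuis1_sup_nuis2] at h
    obtain ⟨a, ⟨ha, h0⟩, h⟩ := h
    have h1 := (condXU_obsScore_eq_iff P hS ha h0).2 h.symm
    refine ⟨a, ha, ?_, h1⟩
    -- Conditioning the integral equation on `X` gives $\mathbb E[a\mid X]=\mathbb E[S_\theta\mid
    -- X]=0$.
    rw [← condX_condO, ← condX_condXU, ← h1, condX_condXU, condX_obsScore]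

/-! ### Matrix moments and the action of constant matrices. -/

lemma integrable_coord_mul (g h : P.L2) (i j : ParamIdx p) :
    Integrable (fun d => g d i * h d j) P.law :=
  ((Lp.memLp g).eval_piLp i).integrable_mul ((Lp.memLp h).eval_piLp j)

lemma crossMoment_transpose (g h : P.L2) : (P.crossMoment g h).transpose = P.crossMoment h g := by
  ext i j
  simp [Model.Point.crossMoment, mul_comm]

lemma crossMoment_add_left (g g' h : P.L2) :
    P.crossMoment (g + g') h = P.crossMoment g h + P.crossMoment g' h := by
  ext i j
  simp only [Model.Point.crossMoment, Matrix.add_apply, Matrix.of_apply]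
  rw [← integral_add (integrable_coord_mul P g h i j) (integrable_coord_mul P g' h i j)]
  refine integral_congr_ae ?_
  filter_upwards [Lp.coeFn_add g g'] with d hd
  rw [hd, Pi.add_apply, PiLp.add_apply, add_mul]

lemma crossMoment_add_right (g h h' : P.L2) :
    P.crossMoment g (h + h') = P.crossMoment g h + P.crossMoment g h' := by
  rw [← crossMoment_transpose, crossMoment_add_left, Matrix.transpose_add,
    crossMoment_transpose, crossMoment_transpose]

lemma inner_eq_trace (g h : P.L2) : ⟪g, h⟫_ℝ = (P.crossMoment g h).trace := by
  rw [L2.inner_def, Matrix.trace]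
  simp only [Model.Point.crossMoment, Matrix.diag_apply, Matrix.of_apply]
  rw [← integral_finsetSum _ fun i _ => integrable_coord_mul P g h i i]
  simp [PiLp.inner_apply, mul_comm]

/-- Multiplication of `L²` functions by a constant matrix. -/
def Model.Point.matAct (A : Matrix (ParamIdx p) (ParamIdx p) ℝ) : P.L2 →L[ℝ] P.L2 :=
  (Matrix.toEuclideanCLM (𝕜 := ℝ) A).compLpL 2 P.law

lemma coeFn_matAct (A : Matrix (ParamIdx p) (ParamIdx p) ℝ) (g : P.L2) :
    ∀ᵐ d ∂P.law, (P.matAct A g d : ParamIdx p → ℝ) = A.mulVec (g d) := by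
  filter_upwards [(Matrix.toEuclideanCLM (𝕜 := ℝ) A).coeFn_compLpL (p := 2) g] with d hd
  rw [Model.Point.matAct, hd, Matrix.ofLp_toEuclideanCLM]

lemma crossMoment_matAct_left (A : Matrix (ParamIdx p) (ParamIdx p) ℝ) (g h : P.L2) :
    P.crossMoment (P.matAct A g) h = A * P.crossMoment g h := by
  ext i j
  simp only [Model.Point.crossMoment, Matrix.mul_apply, Matrix.of_apply]
  simp_rw [← integral_const_mul]
  rw [← integral_finsetSum _ fun k _ => (integrable_coord_mul P g h k j).const_mul _]
  refine integral_congr_ae ?_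
  filter_upwards [coeFn_matAct P A g] with d hd
  rw [hd]
  simp only [Matrix.mulVec, dotProduct, Finset.sum_mul, mul_assoc]

lemma crossMoment_matAct_right (A : Matrix (ParamIdx p) (ParamIdx p) ℝ) (g h : P.L2) :
    P.crossMoment g (P.matAct A h) = P.crossMoment g h * A.transpose := by
  rw [← crossMoment_transpose, crossMoment_matAct_left, Matrix.transpose_mul,
    crossMoment_transpose]

lemma matAct_mem_meanZero {A : Matrix (ParamIdx p) (ParamIdx p) ℝ} {g : P.L2}
    (hg : g ∈ P.meanZero) : P.matAct A g ∈ P.meanZero := by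
  change ∫ d, (Matrix.toEuclideanCLM (𝕜 := ℝ) A).compLpL 2 P.law g d ∂P.law = 0
  rw [integral_congr_ae ((Matrix.toEuclideanCLM (𝕜 := ℝ) A).coeFn_compLpL g),
    ContinuousLinearMap.integral_comp_comm _ ((Lp.memLp g).integrable (by norm_num)),
    show ∫ d, g d ∂P.law = 0 from hg, map_zero]

/-- Constant matrices commute with conditioning and preserve measurability and mean zero; continuity
passes this to the closure. -/
lemma matAct_mem_nuis (A : Matrix (ParamIdx p) (ParamIdx p) ℝ) {g : P.L2} (hg : g ∈ P.nuis) :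
    P.matAct A g ∈ P.nuis := by
  have hle : P.nuis1 ⊔ P.nuis2 ≤ P.nuis.comap (P.matAct A).toLinearMap := by
    rw [nuis1_sup_nuis2]
    rintro _ ⟨b, hb, rfl⟩
    refine Submodule.le_topologicalClosure _ ?_
    rw [nuis1_sup_nuis2]
    exact ⟨P.matAct A b, ⟨compLpL_mem_measL2 hb.1, matAct_mem_meanZero P hb.2⟩,
      condL2_compLpL _ _ b⟩
  exact Submodule.topologicalClosure_minimal _ hle
    ((Submodule.isClosed_topologicalClosure _).preimage (P.matAct A).continuous) hg

/-- Orthogonality to the nuisance tangent space holds coordinate by coordinate. -/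
lemma crossMoment_eq_zero {g h : P.L2} (hg : g ∈ P.nuisᗮ) (hh : h ∈ P.nuis) :
    P.crossMoment g h = 0 := by
  ext i j
  -- Acting on `h` by a matrix unit makes the trace pick out the `(i, j)` entry.
  have h1 := (Submodule.mem_orthogonal' _ _).1 hg _
    (matAct_mem_nuis P (Matrix.single i j (1 : ℝ)) hh)
  rw [inner_eq_trace, crossMoment_matAct_right, Matrix.transpose_single,
    Matrix.trace_mul_single] at h1
  simpa using h1

lemma matAct_mem_orthogonal_nuis (A : Matrix (ParamIdx p) (ParamIdx p) ℝ) {g : P.L2}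
    (hg : g ∈ P.nuisᗮ) : P.matAct A g ∈ P.nuisᗮ := by
  rw [Submodule.mem_orthogonal']
  intro h hh
  rw [inner_eq_trace, crossMoment_matAct_left, crossMoment_eq_zero P hg hh, mul_zero,
    Matrix.trace_zero]

lemma posSemidef_crossMoment (g : P.L2) : (P.crossMoment g g).PosSemidef := by
  refine Matrix.PosSemidef.of_dotProduct_mulVec_nonneg ?_ fun x => ?_
  · rw [Matrix.IsHermitian, Matrix.conjTranspose_eq_transpose_of_trivial, crossMoment_transpose]
  -- Every row of `A` is `x`, so each coordinate of $Ag$ is $x^Tg$ and the quadratic form is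
  -- $\mathbb E[(x^Tg)^2]$. The index `k` is arbitrary; that of $\beta$ exists even when `p = 0`.
  · set A : Matrix (ParamIdx p) (ParamIdx p) ℝ := Matrix.of fun _ j => x j with hA
    set k : ParamIdx p := Sum.inr (Sum.inl ())
    have h1 : star x ⬝ᵥ (P.crossMoment g g).mulVec x =
        (A * P.crossMoment g g * A.transpose) k k := by
      rw [Matrix.mul_assoc, Matrix.mul_apply]
      simp [hA, dotProduct, Matrix.mulVec, Matrix.mul_apply]
    rw [h1, ← crossMoment_matAct_left, ← crossMoment_matAct_right]
    exact integral_nonneg fun d => mul_self_nonneg _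

lemma crossMoment_add_self_of_eq_zero {g h : P.L2} (hgh : P.crossMoment g h = 0) :
    P.crossMoment (g + h) (g + h) = P.crossMoment g g + P.crossMoment h h := by
  have hhg : P.crossMoment h g = 0 := by rw [← crossMoment_transpose, hgh, Matrix.transpose_zero]
  rw [crossMoment_add_left, crossMoment_add_right, crossMoment_add_right, hgh, hhg, add_zero,
    zero_add]

/-! ### Information bound, influence functions and variance bound. -/

lemma effScore_mem_L2O : P.effScore hS ∈ P.L2O :=
  sub_mem (obsScore_mem_L2O P hS) (nuis_le_L2O P (proj_mem P _))

lemma effScore_mem_meanZero : P.effScore hS ∈ P.meanZero :=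
  sub_mem (obsScore_mem_meanZero P hS) (nuis_le_meanZero P (proj_mem P _))

lemma effScore_mem_orthogonal : P.effScore hS ∈ P.nuisᗮ := sub_proj_mem P _

/-- Lets the normalisation of an influence function be read with $S_{\rm eff}$ in place of
$S_\theta$. -/
lemma crossMoment_obsScore {g : P.L2} (hg : g ∈ P.nuisᗮ) :
    P.crossMoment g (P.obsScore hS) = P.crossMoment g (P.effScore hS) := by
  conv_lhs => rw [← sub_add_cancel (P.obsScore hS) (P.proj (P.obsScore hS)),
    crossMoment_add_right, crossMoment_eq_zero P hg (proj_mem P _), add_zero]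
  rfl

lemma isInformationBound :
    P.IsInformationBound hS (P.crossMoment (P.effScore hS) (P.effScore hS)) := by
  refine ⟨⟨_, proj_mem P _, rfl⟩, ?_⟩
  rintro _ ⟨g, hg, rfl⟩
  have hd : P.proj (P.obsScore hS) - g ∈ P.nuis := sub_mem (proj_mem P _) hg
  have he : P.obsScore hS - g = P.effScore hS + (P.proj (P.obsScore hS) - g) := by
    rw [Model.Point.effScore]
    abel
  rw [he, crossMoment_add_self_of_eq_zero P
    (crossMoment_eq_zero P (effScore_mem_orthogonal P hS) hd), add_sub_cancel_left]
  exact posSemidef_crossMoment P _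

/-- A null vector $v$ of $V_{\rm eff}$ gives $v^TS_{\rm eff}=0$ almost surely, whereas $\mathbb
E[\varphi\,S_{\rm eff}^T]v=v$. -/
lemma det_ne_zero_of_isInfluence {φ : P.L2} (hφ : P.IsInfluence hS φ) :
    (P.crossMoment (P.effScore hS) (P.effScore hS)).det ≠ 0 := by
  intro hdet
  obtain ⟨v, hv, hv0⟩ := Matrix.exists_vecMul_eq_zero_iff.2 hdet
  set A : Matrix (ParamIdx p) (ParamIdx p) ℝ := Matrix.of fun _ j => v j with hA
  have hAV : A * P.crossMoment (P.effScore hS) (P.effScore hS) = 0 := by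
    ext i j
    exact congrFun hv0 j
  have h0 : P.matAct A (P.effScore hS) = 0 := by
    rw [← inner_self_eq_zero (𝕜 := ℝ), inner_eq_trace, crossMoment_matAct_left,
      crossMoment_matAct_right, ← Matrix.mul_assoc, hAV, Matrix.zero_mul, Matrix.trace_zero]
  have h1 : P.crossMoment φ (P.matAct A (P.effScore hS)) = A.transpose := by
    rw [crossMoment_matAct_right, ← crossMoment_obsScore P hS hφ.2.2.1, hφ.2.2.2, one_mul]
  rw [h0, crossMoment_eq_zero P hφ.2.2.1 (zero_mem _)] at h1
  refine hv (funext fun j => ?_)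
  exact (congrFun (congrFun h1 j) (Sum.inr (Sum.inl ()))).symm

/-- The candidate `V⁻¹ S_eff` for the efficient influence function. -/
def Model.Point.effInfluence : P.L2 :=
  P.matAct (P.crossMoment (P.effScore hS) (P.effScore hS))⁻¹ (P.effScore hS)

/-- The value does not depend on `ψ`, so differences of influence functions are uncorrelated with
the candidate; this is what makes it optimal. -/
lemma crossMoment_effInfluence_of_isInfluence {ψ : P.L2} (hψ : P.IsInfluence hS ψ) :
    P.crossMoment ψ (P.effInfluence hS) =
      (P.crossMoment (P.effScore hS) (P.effScore hS))⁻¹ := by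
  rw [Model.Point.effInfluence, crossMoment_matAct_right, ← crossMoment_obsScore P hS hψ.2.2.1,
    hψ.2.2.2, one_mul, Matrix.transpose_nonsing_inv, crossMoment_transpose]

lemma isInfluence_effInfluence
    (hdet : (P.crossMoment (P.effScore hS) (P.effScore hS)).det ≠ 0) :
    P.IsInfluence hS (P.effInfluence hS) := by
  have horth : P.effInfluence hS ∈ P.nuisᗮ :=
    matAct_mem_orthogonal_nuis P _ (effScore_mem_orthogonal P hS)
  refine ⟨compLpL_mem_measL2 (effScore_mem_L2O P hS),
    matAct_mem_meanZero P (effScore_mem_meanZero P hS), horth, ?_⟩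
  rw [crossMoment_obsScore P hS horth, Model.Point.effInfluence, crossMoment_matAct_left,
    Matrix.nonsing_inv_mul _ hdet.isUnit]

lemma isEfficientInfluence_effInfluence
    (hdet : (P.crossMoment (P.effScore hS) (P.effScore hS)).det ≠ 0) :
    P.IsEfficientInfluence hS (P.effInfluence hS) := by
  have hφ := isInfluence_effInfluence P hS hdet
  refine ⟨hφ, ⟨_, hφ, rfl⟩, ?_⟩
  rintro _ ⟨ψ, hψ, rfl⟩
  set φ := P.effInfluence hS
  have h0 : P.crossMoment (ψ - φ) φ = 0 := by
    have h1 := crossMoment_add_left P (ψ - φ) φ φ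
    rw [sub_add_cancel, crossMoment_effInfluence_of_isInfluence P hS hψ,
      crossMoment_effInfluence_of_isInfluence P hS hφ] at h1
    exact right_eq_add.1 h1
  have h2 := crossMoment_add_self_of_eq_zero P h0
  rw [sub_add_cancel] at h2
  rw [h2, add_sub_cancel_right]
  exact posSemidef_crossMoment P _

end Sensitivity
end

open Sensitivity in
theorem mainTheorem3 {p : ℕ} (M : Sensitivity.Model) (P : M.Point p)
    (hS : MeasureTheory.MemLp P.fullScore 2 P.law) :
    -- ortho-complement of the nuisance tangent space among the observed data functions,
    -- in the space of all of them and in the space of those with mean zero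
    ({g : P.L2 | g ∈ P.L2O ∧ g ∈ P.nuisᗮ} =
      {g | ∃ h ∈ P.L2O, g = h - P.proj h}) ∧
    ({g : P.L2 | g ∈ P.L2O ∧ g ∈ P.meanZero ∧ g ∈ P.nuisᗮ} =
      {g | ∃ h ∈ P.L2O, h ∈ P.meanZero ∧ g = h - P.proj h}) ∧
    -- the efficient score through the integral equation
    (∀ a ∈ P.L2XU, P.condX a = 0 →
      (P.condXU (P.obsScore hS) =
          P.condXU (P.condO a) ↔
        P.effScore hS = P.obsScore hS - P.condO a)) ∧
    -- solvability of the integral equation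
    ((∃ a ∈ P.L2XU, P.condX a = 0 ∧
        P.condXU (P.obsScore hS) =
          P.condXU (P.condO a)) ↔
      P.proj (P.obsScore hS) ∈ P.nuis1 ⊔ P.nuis2) ∧
    -- the efficiency bound, on the information scale and on the variance scale
    P.IsInformationBound hS (P.crossMoment (P.effScore hS) (P.effScore hS)) ∧
    ((P.crossMoment (P.effScore hS) (P.effScore hS)).det ≠ 0 ↔ ∃ φ, P.IsInfluence hS φ) ∧
    ((P.crossMoment (P.effScore hS) (P.effScore hS)).det ≠ 0 →
      (∃ φ, P.IsEfficientInfluence hS φ ∧ ∀ᵐ d ∂P.law,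
        (φ d : ParamIdx p → ℝ) =
          (P.crossMoment (P.effScore hS) (P.effScore hS))⁻¹.mulVec (P.effScore hS d)) ∧
      P.IsVarianceBound hS (P.crossMoment (P.effScore hS) (P.effScore hS))⁻¹) := by
  refine ⟨?_, ?_, fun a ha h0 => ?_, exists_condXU_eq_iff P hS, isInformationBound P hS,
    ⟨fun h => ⟨_, isInfluence_effInfluence P hS h⟩,
      fun ⟨_, hφ⟩ => det_ne_zero_of_isInfluence P hS hφ⟩,
    fun h => ⟨⟨_, isEfficientInfluence_effInfluence P hS h, coeFn_matAct P _ _⟩,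
      ⟨_, isEfficientInfluence_effInfluence P hS h, ?_⟩⟩⟩
  · ext g
    constructor
    · rintro ⟨hO, hg⟩
      -- An element of the ortho-complement is its own residual.
      exact ⟨g, hO, by rw [proj_eq_zero P hg, sub_zero]⟩
    · rintro ⟨h, hO, rfl⟩
      exact ⟨sub_mem hO (nuis_le_L2O P (proj_mem P h)), sub_proj_mem P h⟩
  · ext g
    constructor
    · rintro ⟨hO, hm, hg⟩
      exact ⟨g, hO, hm, by rw [proj_eq_zero P hg, sub_zero]⟩
    · rintro ⟨h, hO, hm, rfl⟩
      exact ⟨sub_mem hO (nuis_le_L2O P (proj_mem P h)),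
        sub_mem hm (nuis_le_meanZero P (proj_mem P h)), sub_proj_mem P h⟩
  · rw [condXU_obsScore_eq_iff P hS ha (mem_meanZero_of_condX_eq_zero P h0),
      Model.Point.effScore, sub_right_inj]
  -- The variance of the candidate is its cross moment with itself, being one of the influence
  -- functions.
  · exact (crossMoment_effInfluence_of_isInfluence P hS
      (isInfluence_effInfluence P hS h)).symm
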